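/- For integers $a_1,a_2,a_3,b$ let $eq=\mathrm{eq}(a_1,a_2,a_3,b)$ denote the equation $a_1x_1+a_2x_2+a_3x_3=b$. For $m\ge 1$, an exact $r$-coloring of $\mathbb{Z}_m=\mathbb{Z}/m\mathbb{Z}$ is a surjective function $c:\mathbb{Z}_m\to\{1,\dots,r\}$, and a rainbow solution of $eq$ with respect to $c$ is a triple $(s_1,s_2,s_3)\in\mathbb{Z}_m^3$ with $a_1s_1+a_2s_2+a_3s_3=b$ in $\mathbb{Z}_m$ and $|\{c(s_1),c(s_2),c(s_3)\}|=3$. The rainbow number $\mathrm{rb}(\mathbb{Z}_m,eq)$ is the smallest positive integer $r$ such that every exact $r$-coloring of $\mathbb{Z}_m$ has a rainbow solution of $eq$; in particular it is $m+1$ if the exact $m$-colorings have no rainbow solution. Let $n=p_1^{\alpha_1}p_2^{\alpha_2}\cdots p_\ell^{\alpha_\ell}$ with $p_1,\dots,p_\ell$ prime and $\alpha_1,\dots,\alpha_\ell$ non-negative integers, and let $a_1,a_2,a_3,b$ be integers such that $a_1+a_2+a_3$ and $a_1a_2a_3$ are both units modulo $n$. Then $$\mathrm{rb}(\mathbb{Z}_n,eq)\;\le\;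 2+\sum_{k=1}^{\ell}\alpha_k\bigl(\mathrm{rb}(\mathbb{Z}_{p_k},eq)-2\bigr).$$ -/

import Mathlib

namespace RainbowZMod

/-- `(s₁, s₂, s₃)` is a solution in `ℤ/nℤ` of the equation `a₁ x₁ + a₂ x₂ + a₃ x₃ = b`. -/
def IsSolution (n : ℕ) (a₁ a₂ a₃ b : ℤ) (s₁ s₂ s₃ : ZMod n) : Prop :=
  (a₁ : ZMod n) * s₁ + (a₂ : ZMod n) * s₂ + (a₃ : ZMod n) * s₃ = (b : ZMod n)

/-- The `r`-coloring `c` of `ℤ/nℤ` has a rainbow solution of `a₁ x₁ + a₂ x₂ + a₃ x₃ = b`: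
a solution whose members receive exactly three colors. -/
def HasRainbowSolution (n : ℕ) (a₁ a₂ a₃ b : ℤ) {r : ℕ} (c : ZMod n → Fin r) : Prop :=
  ∃ s₁ s₂ s₃ : ZMod n, IsSolution n a₁ a₂ a₃ b s₁ s₂ s₃ ∧
    ({c s₁, c s₂, c s₃} : Finset (Fin r)).card = 3

/-- The positive integers `r` such that every exact (that is, surjective) `r`-coloring of `ℤ/nℤ`
has a rainbow solution. -/
def rainbowSet (n : ℕ) (a₁ a₂ a₃ b : ℤ) : Set ℕ :=
  {r : ℕ | 0 < r ∧ ∀ c : ZMod n → Fin r, Function.Surjective c → HasRainbowSolution n a₁ a₂ a₃ b c}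

/-- The rainbow number of `ℤ/nℤ` for `a₁ x₁ + a₂ x₂ + a₃ x₃ = b`: the least positive `r` such that
every exact `r`-coloring has a rainbow solution. For `n ≠ 0` the set is never empty, as it contains
`n + 1` vacuously; this is the convention that the rainbow number is `n + 1` if exact
`n`-colorings have no rainbow solution (see `rainbowNumber_eq_succ`). -/
noncomputable def rainbowNumber (n : ℕ) (a₁ a₂ a₃ b : ℤ) : ℕ :=
  sInf (rainbowSet n a₁ a₂ a₃ b)

theorem succ_mem_rainbowSet (n : ℕ) [NeZero n] (a₁ a₂ a₃ b : ℤ) :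
    n + 1 ∈ rainbowSet n a₁ a₂ a₃ b := by
  refine ⟨Nat.succ_pos n, fun c hc => ?_⟩
  have h := Fintype.card_le_of_surjective c hc
  rw [Fintype.card_fin, ZMod.card] at h
  omega

/-- The rainbow number is the least element of the set that defines it. -/
theorem isLeast_rainbowNumber (n : ℕ) [NeZero n] (a₁ a₂ a₃ b : ℤ) :
    IsLeast (rainbowSet n a₁ a₂ a₃ b) (rainbowNumber n a₁ a₂ a₃ b) :=
  ⟨Nat.sInf_mem ⟨_, succ_mem_rainbowSet n a₁ a₂ a₃ b⟩, fun _ hr => Nat.sInf_le hr⟩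

/-- The convention for `rainbowNumber`: if an exact `n`-coloring has no rainbow solution,
the rainbow number is `n + 1`. -/
theorem rainbowNumber_eq_succ (n : ℕ) [NeZero n] (a₁ a₂ a₃ b : ℤ) (c : ZMod n → Fin n)
    (hc : Function.Surjective c) (h : ¬ HasRainbowSolution n a₁ a₂ a₃ b c) :
    rainbowNumber n a₁ a₂ a₃ b = n + 1 := by
  have hinj : Function.Injective c :=
    ((Fintype.bijective_iff_surjective_and_card c).2 ⟨hc, by simp [ZMod.card]⟩).1
  refine le_antisymm ((isLeast_rainbowNumber n a₁ a₂ a₃ b).2 (succ_mem_rainbowSet n a₁ a₂ a₃ b)) ?_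
  by_contra hlt
  obtain ⟨hpos, hall⟩ := (isLeast_rainbowNumber n a₁ a₂ a₃ b).1
  set r := rainbowNumber n a₁ a₂ a₃ b
  have hrn : r ≤ n := by omega
  let f : Fin n → Fin r := fun i => if hi : (i : ℕ) < r then ⟨i, hi⟩ else ⟨0, hpos⟩
  have hf : Function.Surjective f := fun j => ⟨⟨j, by omega⟩, by simp [f]⟩
  obtain ⟨s₁, s₂, s₃, hs, hcard⟩ := hall (f ∘ c) (hf.comp hc)
  refine h ⟨s₁, s₂, s₃, hs, le_antisymm Finset.card_le_three ?_⟩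
  have himg : ({(f ∘ c) s₁, (f ∘ c) s₂, (f ∘ c) s₃} : Finset (Fin r)) =
      ({c s₁, c s₂, c s₃} : Finset (Fin n)).image f := by
    simp [Finset.image_insert]
  rw [← hcard, himg]
  exact Finset.card_image_le

end RainbowZMod

/-! ### Rainbow-free colorings and reduction to the homogeneous equation. -/

namespace RainbowZMod

/-! Prime factors are split off one at a time (`rainbowNumber_mul_le`). Given a rainbow-free
coloring of `ℤ/ptℤ`, a translation makes `b = 0`, since the coefficient sum is a unit. The multiples
of `p` then carry a rainbow-free coloring for `ℤ/tℤ`, so they use at most `rb(t) - 1` colors.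

Assign to each residue class mod `p` the set of its colors absent from class `0`. Solutions mod `p`
lift, which makes this assignment triple-closed (`tripleClosed_newColors`). At most one class then
carries several new colors (`TripleClosed.eq_of_nontrivial`), and one color per class can be chosen
without losing any (`TripleClosed.exists_rainbowFree`). With `none` on empty classes this is a
rainbow-free coloring of `ℤ/pℤ`; as `none` is itself a color, there are at most `rb(p) - 2` new
colors. -/

/-- No solution of `a₁ x₁ + a₂ x₂ + a₃ x₃ = b` has three distinct colors under `c`. -/
def RainbowFree {R κ : Type*} [CommRing R] (a₁ a₂ a₃ b : R) (c : R → κ) : Prop :=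
  ∀ x y z : R, a₁ * x + a₂ * y + a₃ * z = b → c x = c y ∨ c x = c z ∨ c y = c z

theorem hasRainbowSolution_iff (n : ℕ) (a₁ a₂ a₃ b : ℤ) {r : ℕ} (c : ZMod n → Fin r) :
    HasRainbowSolution n a₁ a₂ a₃ b c ↔ ¬ RainbowFree (a₁ : ZMod n) a₂ a₃ b c := by
  simp only [HasRainbowSolution, IsSolution, RainbowFree, Finset.card_eq_three]
  push Not
  refine exists_congr fun x => exists_congr fun y => exists_congr fun z => and_congr_right
    fun _ => ⟨fun ⟨u, v, w, huv, huw, hvw, h⟩ => ?_, fun h => ⟨_, _, _, h.1, h.2.1, h.2.2, rfl⟩⟩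
  have hcard : ({c x, c y, c z} : Finset (Fin r)).card = 3 := by
    rw [h]; exact Finset.card_eq_three.2 ⟨u, v, w, huv, huw, hvw, rfl⟩
  have hpair : ∀ u v : Fin r, ({u, v} : Finset (Fin r)).card ≠ 3 := fun u v h => by
    have := Finset.card_le_two (a := u) (b := v)
    omega
  refine ⟨fun e => hpair (c y) (c z) ?_, fun e => hpair (c z) (c y) ?_,
    fun e => hpair (c x) (c z) ?_⟩
  · simpa [e] using hcard
  · simpa [e, Finset.pair_comm] using hcard
  · simpa [e] using hcard

theorem two_le_rainbowNumber (n : ℕ) [NeZero n] (a₁ a₂ a₃ b : ℤ) :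
    2 ≤ rainbowNumber n a₁ a₂ a₃ b := by
  obtain ⟨hpos, hall⟩ := (isLeast_rainbowNumber n a₁ a₂ a₃ b).1
  by_contra hlt
  have h1 : rainbowNumber n a₁ a₂ a₃ b = 1 := by omega
  rw [h1] at hall
  refine (hasRainbowSolution_iff n a₁ a₂ a₃ b _).1
    (hall (fun _ => 0) fun j => ⟨0, Subsingleton.elim _ _⟩) fun _ _ _ _ => Or.inl rfl

/-- A rainbow-free coloring uses fewer colors than the rainbow number. -/
theorem RainbowFree.ncard_range_lt {n : ℕ} [NeZero n] {a₁ a₂ a₃ b : ℤ} {κ : Type*}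
    {c : ZMod n → κ} (hc : RainbowFree (a₁ : ZMod n) a₂ a₃ b c) :
    (Set.range c).ncard < rainbowNumber n a₁ a₂ a₃ b := by
  by_contra! hle
  obtain ⟨hpos, hall⟩ := (isLeast_rainbowNumber n a₁ a₂ a₃ b).1
  set r := rainbowNumber n a₁ a₂ a₃ b
  have : Fintype (Set.range c) := Fintype.ofFinite _
  rw [← Nat.card_coe_set_eq, Nat.card_eq_fintype_card] at hle
  have : Nonempty (Fin r) := ⟨⟨0, hpos⟩⟩
  obtain ⟨g⟩ : Nonempty (Fin r ↪ Set.range c) :=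
    Function.Embedding.nonempty_of_card_le (by simpa using hle)
  -- Surplus colors are merged; merging cannot create a rainbow solution.
  let f : ZMod n → Fin r := fun x => Function.invFun g ⟨c x, x, rfl⟩
  have hf : Function.Surjective f := fun j => by
    obtain ⟨x, hx⟩ := (g j).2
    refine ⟨x, ?_⟩
    have : (⟨c x, x, rfl⟩ : Set.range c) = g j := Subtype.ext hx
    simp only [f, this]
    exact Function.leftInverse_invFun g.injective j
  refine (hasRainbowSolution_iff n a₁ a₂ a₃ b f).1 (hall f hf) fun x y z h => ?_
  have key : ∀ x y, c x = c y → f x = f y := fun x y h => by simp only [f, h]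
  exact (hc x y z h).imp (key _ _) (Or.imp (key _ _) (key _ _))

/-- Translating the argument by a constant solution makes the equation homogeneous. -/
theorem RainbowFree.translate {R κ : Type*} [CommRing R] {a₁ a₂ a₃ b b' e : R} {c : R → κ}
    (hc : RainbowFree a₁ a₂ a₃ b c) (he : b' + (a₁ + a₂ + a₃) * e = b) :
    RainbowFree a₁ a₂ a₃ b' (fun x => c (x + e)) :=
  fun x y z h => hc _ _ _ (by rw [← he, ← h]; ring)

theorem range_comp_add {R κ : Type*} [AddGroup R] (c : R → κ) (e : R) :
    Set.range (fun x => c (x + e)) = Set.range c :=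
  (Equiv.addRight e).surjective.range_comp c

theorem RainbowFree.ncard_range_lt_of_isUnit {n : ℕ} [NeZero n] {a₁ a₂ a₃ : ℤ} (b : ℤ)
    (hs : IsUnit (a₁ + a₂ + a₃ : ZMod n)) {κ : Type*} {c : ZMod n → κ}
    (hc : RainbowFree (a₁ : ZMod n) a₂ a₃ 0 c) :
    (Set.range c).ncard < rainbowNumber n a₁ a₂ a₃ b := by
  obtain ⟨s, hs⟩ := hs
  rw [← range_comp_add c (-(↑s⁻¹ * (b : ZMod n)))]
  refine (hc.translate (b' := (b : ZMod n)) ?_).ncard_range_lt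
  rw [← hs, mul_neg, Units.mul_inv_cancel_left, add_neg_cancel]

/-! ### Triple-closed set-valued colorings of a prime field. -/

/-- A set-valued coloring of a prime field is triple-closed for a homogeneous equation if the
colors `u ≠ v` of two members of a solution are never both missing from the third member. -/
def TripleClosed {F κ : Type*} [Field F] (a₁ a₂ a₃ : F) (Q : F → Set κ) : Prop :=
  ∀ i j k : F, a₁ * i + a₂ * j + a₃ * k = 0 → ∀ u v : κ, u ≠ v →
    (u ∈ Q i → v ∈ Q j → u ∈ Q k ∨ v ∈ Q k) ∧
    (u ∈ Q i → v ∈ Q k → u ∈ Q j ∨ v ∈ Q j) ∧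
    (u ∈ Q j → v ∈ Q k → u ∈ Q i ∨ v ∈ Q i)

section PrimeField

variable {p : ℕ} [Fact p.Prime] {κ : Type*} {a₁ a₂ a₃ : ZMod p} {Q : ZMod p → Set κ}

/-- One of two colors at `i` differs from a given color at `j`, so closure forces a color on the
third member. -/
theorem TripleClosed.nonempty_of_nontrivial (h₃ : a₃ ≠ 0) (hQ : TripleClosed a₁ a₂ a₃ Q)
    {i j : ZMod p} (hi : (Q i).Nontrivial) (hj : (Q j).Nonempty) :
    (Q (-(a₁ * i + a₂ * j) / a₃)).Nonempty := by
  obtain ⟨w, hw⟩ := hj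
  obtain ⟨u, hu, huw⟩ := hi.exists_ne w
  have hsol : a₁ * i + a₂ * j + a₃ * (-(a₁ * i + a₂ * j) / a₃) = 0 := by field_simp; ring
  rcases (hQ _ _ _ hsol u w huw).1 hu hw with h | h
  exacts [⟨_, h⟩, ⟨_, h⟩]

/-- At most one class carries two colors, since otherwise the set of classes that carry a color
would be invariant under a nonzero translation. -/
theorem TripleClosed.eq_of_nontrivial (h₁ : a₁ ≠ 0) (h₂ : a₂ ≠ 0) (h₃ : a₃ ≠ 0)
    (hQ : TripleClosed a₁ a₂ a₃ Q) (h0 : Q 0 = ∅)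
    {i j : ZMod p} (hi : (Q i).Nontrivial) (hj : (Q j).Nontrivial) : i = j := by
  by_contra hij
  let S : Set (ZMod p) := {k | (Q k).Nonempty}
  let F : ZMod p → ZMod p → ZMod p := fun i k => -(a₁ * i + a₂ * k) / a₃
  have hFi : Set.MapsTo (F i) S S := fun k hk => hQ.nonempty_of_nontrivial h₃ hi hk
  have hFj : Set.MapsTo (F j) S S := fun k hk => hQ.nonempty_of_nontrivial h₃ hj hk
  have hinj : Set.InjOn (F i) S := fun k _ l _ h => by
    simp only [F] at h
    field_simp at h
    have h' : a₂ * k = a₂ * l := by linear_combination -h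
    exact mul_left_cancel₀ h₂ h'
  have hsurj : Set.SurjOn (F i) S S := fun s hs => by
    obtain ⟨k, hk, h⟩ := Set.surj_on_of_inj_on_of_ncard_le (fun k (_ : k ∈ S) => F i k) hFi
      (fun k l hk hl h => hinj hk hl h) le_rfl (Set.toFinite S) s hs
    exact ⟨k, hk, h.symm⟩
  set δ : ZMod p := a₁ * (i - j) / a₃ with hδ
  have hδ0 : δ ≠ 0 := div_ne_zero (mul_ne_zero h₁ (sub_ne_zero.2 hij)) h₃
  -- `F i` permutes the finite set `S`, and `F j` is `F i` followed by translation by `δ`.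
  have hshift : ∀ s ∈ S, s + δ ∈ S := fun s hs => by
    obtain ⟨k, hk, rfl⟩ := hsurj hs
    have : F i k + δ = F j k := by simp only [F, hδ]; field_simp; ring
    rw [this]
    exact hFj hk
  have hmult : ∀ m : ℕ, i + m * δ ∈ S := fun m => by
    induction m with
    | zero => simpa [S] using hi.nonempty
    | succ m ih => convert hshift _ ih using 1; push_cast; ring
  -- This multiple of `δ` carries `i` to `0`, whose class is empty.
  have h := hmult (-i / δ).val
  rw [ZMod.natCast_zmod_val, div_mul_cancel₀ _ hδ0, add_neg_cancel] at h
  exact h.ne_empty h0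

/-- A triple-closed set-valued coloring has a rainbow-free choice that keeps every color. -/
theorem TripleClosed.exists_rainbowFree (h₁ : a₁ ≠ 0) (h₂ : a₂ ≠ 0) (h₃ : a₃ ≠ 0)
    (hs : a₁ + a₂ + a₃ ≠ 0) (hQ : TripleClosed a₁ a₂ a₃ Q) (h0 : Q 0 = ∅) :
    ∃ f : ZMod p → Option κ, RainbowFree a₁ a₂ a₃ 0 f ∧ f 0 = none ∧
      ∀ j, ∀ u ∈ Q j, some u ∈ Set.range f := by
  classical
  have huniq : ∀ {i j}, (Q i).Nontrivial → (Q j).Nontrivial → i = j :=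
    fun hi hj => hQ.eq_of_nontrivial h₁ h₂ h₃ h0 hi hj
  -- Any such selection is rainbow-free. If one value is `none`, closure puts a color on an empty
  -- class; if all three are colors, closure makes two of the classes nontrivial, hence equal.
  suffices H : ∃ f : ZMod p → Option κ, (∀ j u, f j = some u → u ∈ Q j) ∧
      (∀ j, f j = none → Q j = ∅) ∧ ∀ j, ∀ u ∈ Q j, some u ∈ Set.range f by
    obtain ⟨f, hmem, hnone, hcov⟩ := H
    refine ⟨f, fun i j k hsol => ?_, ?_, hcov⟩
    · by_contra! ⟨hij, hik, hjk⟩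
      have hcl := hQ i j k hsol
      rcases hi : f i with _ | u <;> rcases hj : f j with _ | v <;> rcases hk : f k with _ | w <;>
        simp only [hi, hj, hk, ne_eq, not_true_eq_false, Option.some.injEq, reduceCtorEq,
          not_false_eq_true] at hij hik hjk
      · have := (hcl v w hjk).2.2 (hmem _ _ hj) (hmem _ _ hk)
        simp [hnone _ hi] at this
      · have := (hcl u w hik).2.1 (hmem _ _ hi) (hmem _ _ hk)
        simp [hnone _ hj] at this
      · have := (hcl u v hij).1 (hmem _ _ hi) (hmem _ _ hj)
        simp [hnone _ hk] at this
      · have hi' := hmem _ _ hi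
        have hj' := hmem _ _ hj
        have hk' := hmem _ _ hk
        have hkn : (Q k).Nontrivial := by
          rcases (hcl u v hij).1 hi' hj' with h | h
          exacts [⟨u, h, w, hk', hik⟩, ⟨v, h, w, hk', hjk⟩]
        have hjn : (Q j).Nontrivial := by
          rcases (hcl u w hik).2.1 hi' hk' with h | h
          exacts [⟨u, h, v, hj', hij⟩, ⟨w, h, v, hj', Ne.symm hjk⟩]
        have := huniq hjn hkn
        rw [this, hk] at hj
        exact hjk (Option.some.inj hj).symm
    · rcases h : f 0 with _ | u
      · rfl
      · simpa [h0] using hmem _ _ h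
  let f : ZMod p → Option κ := fun j => if h : (Q j).Nonempty then some h.some else none
  have hmem : ∀ j u, f j = some u → u ∈ Q j := fun j u h => by
    by_cases hne : (Q j).Nonempty
    · simp only [f, hne, dif_pos, Option.some.injEq] at h
      exact h ▸ hne.some_mem
    · simp [f, hne] at h
  have hnone : ∀ j, f j = none → Q j = ∅ := fun j h => by
    by_contra hne
    simp [f, Set.nonempty_iff_ne_empty.2 hne] at h
  have hsingle : ∀ j, ¬ (Q j).Nontrivial → ∀ u ∈ Q j, f j = some u := fun j hj u hu => by
    rcases h : f j with _ | v
    · simp [hnone _ h] at hu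
    · rw [Set.not_nontrivial_iff.1 hj hu (hmem _ _ h)]
  by_cases hex : ∃ i, (Q i).Nontrivial
  swap
  · exact ⟨f, hmem, hnone, fun j u hu => ⟨j, hsingle j (fun h => hex ⟨j, h⟩) u hu⟩⟩
  obtain ⟨i, hi⟩ := hex
  have hi0 : i ≠ 0 := by
    rintro rfl
    exact hi.nonempty.ne_empty h0
  -- Solving with `i` used twice gives a class `l ≠ i` whose color set meets every pair from `Q i`.
  -- As `Q l` has a single color `u`, `Q i` has only `u` and one other color `v`: keep `v` at `i`
  -- and leave `u` to `l`.
  obtain ⟨l, hl⟩ : ∃ l, l = -(a₁ * i + a₂ * i) / a₃ := ⟨_, rfl⟩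
  have hsol : a₁ * i + a₂ * i + a₃ * l = 0 := by rw [hl]; field_simp; ring
  have hli : l ≠ i := by
    rintro rfl
    exact mul_ne_zero hs hi0 (by linear_combination hsol)
  have hlt : ¬ (Q l).Nontrivial := fun h => hli (huniq h hi)
  have hhit : ∀ u ∈ Q i, ∀ v ∈ Q i, u ≠ v → u ∈ Q l ∨ v ∈ Q l :=
    fun u hu v hv huv => (hQ i i l hsol u v huv).1 hu hv
  obtain ⟨u, hul, v, hv, huv⟩ : ∃ u, u ∈ Q l ∧ ∃ v, v ∈ Q i ∧ u ≠ v := by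
    obtain ⟨u, hu, v, hv, huv⟩ := hi
    rcases hhit u hu v hv huv with h | h
    exacts [⟨u, h, v, hv, huv⟩, ⟨v, h, u, hu, huv.symm⟩]
  refine ⟨Function.update f i (some v), fun j w h => ?_, fun j h => ?_, fun j w hw => ?_⟩
  · rcases eq_or_ne j i with rfl | hj
    · rw [Function.update_self] at h
      exact Option.some.inj h ▸ hv
    · rw [Function.update_of_ne hj] at h
      exact hmem _ _ h
  · rcases eq_or_ne j i with rfl | hj
    · simp at h
    · rw [Function.update_of_ne hj] at h
      exact hnone _ h
  · rcases eq_or_ne j i with rfl | hj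
    · rcases eq_or_ne w v with rfl | hwv
      · exact ⟨j, Function.update_self ..⟩
      · refine ⟨l, ?_⟩
        rw [Function.update_of_ne hli]
        refine hsingle l hlt w ((hhit w hw v hv hwv).resolve_right fun h => huv ?_)
        exact Set.not_nontrivial_iff.1 hlt hul h
    · refine ⟨j, ?_⟩
      rw [Function.update_of_ne hj]
      exact hsingle j (fun h => hj (huniq h hi)) w hw

end PrimeField

/-! ### Residue classes modulo a prime factor. -/

/-- Colors of a residue class modulo `p` that do not occur in the class of `0`. -/
def newColors {R F κ : Type*} [CommRing R] [Field F] (π : R →+* F) (c : R → κ) (j : F) : Set κ :=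
  c '' (π ⁻¹' {j}) \ c '' (π ⁻¹' {0})

/-- Two members colored `u` and `v` extend to a solution upstairs because the remaining coefficient
is a unit. The third member has color `u` or `v`, and neither occurs in the class of `0`. -/
theorem tripleClosed_newColors {R F κ : Type*} [CommRing R] [Field F] (π : R →+* F) {c : R → κ}
    {a₁ a₂ a₃ : R} (h₁ : IsUnit a₁) (h₂ : IsUnit a₂) (h₃ : IsUnit a₃)
    (hc : RainbowFree a₁ a₂ a₃ 0 c) :
    TripleClosed (π a₁) (π a₂) (π a₃) (newColors π c) := by
  have aux : ∀ {a₁ a₂ a₃ : R}, IsUnit a₃ → RainbowFree a₁ a₂ a₃ 0 c →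
      ∀ i j k : F, π a₁ * i + π a₂ * j + π a₃ * k = 0 → ∀ u v : κ, u ≠ v →
      u ∈ newColors π c i → v ∈ newColors π c j → u ∈ newColors π c k ∨ v ∈ newColors π c k := by
    rintro a₁ a₂ _ ⟨a₃, rfl⟩ hc i j k hsol u v huv ⟨⟨x, rfl, rfl⟩, hx⟩ ⟨⟨y, rfl, rfl⟩, hy⟩
    obtain ⟨z, hz⟩ : ∃ z, z = -(↑a₃⁻¹ * (a₁ * x + a₂ * y)) := ⟨_, rfl⟩
    have hxyz : a₁ * x + a₂ * y + a₃ * z = 0 := by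
      rw [hz, mul_neg, Units.mul_inv_cancel_left, add_neg_cancel]
    have ha₃ : π a₃ ≠ 0 := (a₃.isUnit.map π).ne_zero
    have hzk : π z = k := by
      have := congrArg π hxyz
      simp only [map_add, map_mul, map_zero] at this
      exact mul_left_cancel₀ ha₃ (by linear_combination this - hsol)
    rcases hc x y z hxyz with h | h | h
    · exact absurd h huv
    · exact Or.inl ⟨⟨z, hzk, h.symm⟩, hx⟩
    · exact Or.inr ⟨⟨z, hzk, h.symm⟩, hy⟩
  intro i j k hsol u v huv
  refine ⟨aux h₃ hc i j k hsol u v huv, aux (a₁ := a₁) (a₂ := a₃) h₂ ?_ i k j ?_ u v huv,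
    aux (a₁ := a₂) (a₂ := a₃) h₁ ?_ j k i ?_ u v huv⟩
  · intro x y z h
    have := hc x z y (by linear_combination h)
    tauto
  · linear_combination hsol
  · intro x y z h
    have := hc z x y (by linear_combination h)
    have e : ∀ x y, c x = c y ↔ c y = c x := fun _ _ => eq_comm
    rw [e z x, e z y] at this
    tauto
  · linear_combination hsol

/-- The multiples of `p` in `ℤ/ptℤ` form a copy of `ℤ/tℤ` with the same homogeneous equation. -/
theorem RainbowFree.exists_of_multiples {p t : ℕ} [NeZero p] [NeZero t] {κ : Type*}
    {a₁ a₂ a₃ : ℤ} {c : ZMod (p * t) → κ} (hc : RainbowFree (a₁ : ZMod (p * t)) a₂ a₃ 0 c) :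
    ∃ g : ZMod t → κ, RainbowFree (a₁ : ZMod t) a₂ a₃ 0 g ∧
      c '' (ZMod.castHom (dvd_mul_right p t) (ZMod p) ⁻¹' {0}) ⊆ Set.range g := by
  have key : ∀ m : ℤ, (m : ZMod t) = 0 → ((p * m : ℤ) : ZMod (p * t)) = 0 := fun m hm => by
    rw [ZMod.intCast_zmod_eq_zero_iff_dvd] at hm ⊢
    push_cast
    exact mul_dvd_mul_left _ hm
  refine ⟨fun y => c ((p * (y.val : ℤ) : ℤ) : ZMod (p * t)), fun x y z h => hc _ _ _ ?_, ?_⟩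
  · have := key (a₁ * x.val + a₂ * y.val + a₃ * z.val) (by simpa using h)
    rw [← this]
    push_cast
    ring
  · rintro _ ⟨x, hx, rfl⟩
    obtain ⟨m, rfl⟩ := ZMod.intCast_surjective x
    rw [Set.mem_preimage, map_intCast, Set.mem_singleton_iff,
      ZMod.intCast_zmod_eq_zero_iff_dvd] at hx
    obtain ⟨q, rfl⟩ := hx
    refine ⟨(q : ZMod t), congrArg c ?_⟩
    have := key (((q : ZMod t).val : ℤ) - q) (by simp)
    rw [mul_sub, Int.cast_sub, sub_eq_zero] at this
    exact this

/-! ### Splitting off prime factors. -/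

theorem rainbowNumber_mul_le {p t : ℕ} (hp : p.Prime) [NeZero t] (a₁ a₂ a₃ b : ℤ)
    (hsum : IsUnit ((a₁ + a₂ + a₃ : ℤ) : ZMod (p * t)))
    (hprod : IsUnit ((a₁ * a₂ * a₃ : ℤ) : ZMod (p * t))) :
    rainbowNumber (p * t) a₁ a₂ a₃ b ≤
      rainbowNumber t a₁ a₂ a₃ b + (rainbowNumber p a₁ a₂ a₃ b - 2) := by
  have : Fact p.Prime := ⟨hp⟩
  have : NeZero p := ⟨hp.ne_zero⟩
  have hp2 := two_le_rainbowNumber p a₁ a₂ a₃ b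
  have ht2 := two_le_rainbowNumber t a₁ a₂ a₃ b
  refine (isLeast_rainbowNumber (p * t) a₁ a₂ a₃ b).2 ⟨by omega, fun c hsurj => ?_⟩
  rw [hasRainbowSolution_iff]
  intro hc
  have hsum' := hsum
  have hsumt : IsUnit (a₁ + a₂ + a₃ : ZMod t) := by
    simpa using hsum.map (ZMod.castHom (dvd_mul_left t p) (ZMod t))
  let π := ZMod.castHom (dvd_mul_right p t) (ZMod p)
  have hsump : IsUnit (a₁ + a₂ + a₃ : ZMod p) := by simpa using hsum.map π
  push_cast at hprod hsum'
  rw [IsUnit.mul_iff, IsUnit.mul_iff] at hprod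
  obtain ⟨⟨h₁, h₂⟩, h₃⟩ := hprod
  obtain ⟨s, hs⟩ := hsum'
  set e : ZMod (p * t) := ↑s⁻¹ * (b : ZMod (p * t)) with he
  have hc0 := hc.translate (b' := 0) (e := e)
    (by rw [← hs, he, Units.mul_inv_cancel_left, zero_add])
  have hrange := range_comp_add c e
  rw [hsurj.range_eq] at hrange
  generalize (fun x => c (x + e)) = d at hc0 hrange
  obtain ⟨g, hg, hsub⟩ := hc0.exists_of_multiples
  have hcl := tripleClosed_newColors π h₁ h₂ h₃ hc0
  have hu₁ := (h₁.map π).ne_zero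
  have hu₂ := (h₂.map π).ne_zero
  have hu₃ := (h₃.map π).ne_zero
  rw [map_intCast] at hu₁ hu₂ hu₃
  simp only [map_intCast] at hcl
  obtain ⟨f, hf, hf0, hcov⟩ := hcl.exists_rainbowFree hu₁ hu₂ hu₃ hsump.ne_zero
    (by simp [newColors])
  have hgc := hg.ncard_range_lt_of_isUnit b hsumt
  have hfc := hf.ncard_range_lt_of_isUnit b hsump
  -- Colors missed by `g` are all new, and `none` at `0` is one further color of `f`: this extra
  -- color turns `rb(p) - 1` into `rb(p) - 2`.
  have hnew : insert none (some '' (Set.range g)ᶜ) ⊆ Set.range f := by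
    refine Set.insert_subset ⟨0, hf0⟩ ?_
    rintro _ ⟨u, hu, rfl⟩
    obtain ⟨x, rfl⟩ : u ∈ Set.range d := hrange ▸ Set.mem_univ u
    exact hcov (π x) _ ⟨⟨x, rfl, rfl⟩, fun h => hu (hsub h)⟩
  have hle := Set.ncard_le_ncard hnew (Set.toFinite _)
  rw [Set.ncard_insert_of_notMem (by simp) (Set.toFinite _),
    Set.ncard_image_of_injective _ (Option.some_injective _)] at hle
  have htot := Set.ncard_add_ncard_compl (Set.range g)
  rw [Nat.card_eq_fintype_card, Fintype.card_fin] at htot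
  omega

theorem isUnit_intCast_of_dvd {m n : ℕ} (h : m ∣ n) {a : ℤ} (ha : IsUnit (a : ZMod n)) :
    IsUnit (a : ZMod m) := by
  simpa using ha.map (ZMod.castHom h (ZMod m))

theorem rainbowNumber_pow_mul_le {p t : ℕ} (hp : p.Prime) [NeZero t] (k : ℕ) (a₁ a₂ a₃ b : ℤ)
    (hsum : IsUnit ((a₁ + a₂ + a₃ : ℤ) : ZMod (p ^ k * t)))
    (hprod : IsUnit ((a₁ * a₂ * a₃ : ℤ) : ZMod (p ^ k * t))) :
    rainbowNumber (p ^ k * t) a₁ a₂ a₃ b ≤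
      rainbowNumber t a₁ a₂ a₃ b + k * (rainbowNumber p a₁ a₂ a₃ b - 2) := by
  induction k with
  | zero => simp
  | succ k ih =>
    have : NeZero (p ^ k * t) := ⟨mul_ne_zero (pow_ne_zero _ hp.ne_zero) (NeZero.ne t)⟩
    have hmul : p ^ (k + 1) * t = p * (p ^ k * t) := by ring
    rw [hmul] at hsum hprod ⊢
    have h := rainbowNumber_mul_le hp a₁ a₂ a₃ b hsum hprod
    have ih := ih (isUnit_intCast_of_dvd (dvd_mul_left _ _) hsum)
      (isUnit_intCast_of_dvd (dvd_mul_left _ _) hprod)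
    rw [add_mul, one_mul]
    omega

theorem rainbowNumber_prod_le {ι : Type*} (s : Finset ι) (p α : ι → ℕ) (hp : ∀ k, (p k).Prime)
    (a₁ a₂ a₃ b : ℤ) (hsum : IsUnit ((a₁ + a₂ + a₃ : ℤ) : ZMod (∏ k ∈ s, p k ^ α k)))
    (hprod : IsUnit ((a₁ * a₂ * a₃ : ℤ) : ZMod (∏ k ∈ s, p k ^ α k))) :
    rainbowNumber (∏ k ∈ s, p k ^ α k) a₁ a₂ a₃ b ≤
      2 + ∑ k ∈ s, α k * (rainbowNumber (p k) a₁ a₂ a₃ b - 2) := by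
  classical
  induction s using Finset.induction_on with
  | empty =>
    simpa using (isLeast_rainbowNumber 1 a₁ a₂ a₃ b).2 (succ_mem_rainbowSet 1 a₁ a₂ a₃ b)
  | insert i s hi ih =>
    rw [Finset.prod_insert hi] at hsum hprod ⊢
    rw [Finset.sum_insert hi]
    have : NeZero (∏ k ∈ s, p k ^ α k) :=
      ⟨Finset.prod_ne_zero_iff.2 fun k _ => pow_ne_zero _ (hp k).ne_zero⟩
    have h := rainbowNumber_pow_mul_le (hp i) (α i) a₁ a₂ a₃ b hsum hprod
    have ih := ih (isUnit_intCast_of_dvd (dvd_mul_left _ _) hsum)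
      (isUnit_intCast_of_dvd (dvd_mul_left _ _) hprod)
    omega

end RainbowZMod

theorem mainTheorem8 (n ℓ : ℕ) (p α : Fin ℓ → ℕ) (hp : ∀ k, (p k).Prime)
    (hn : n = ∏ k, p k ^ α k) (a₁ a₂ a₃ b : ℤ)
    (hsum : IsUnit ((a₁ + a₂ + a₃ : ℤ) : ZMod n))
    (hprod : IsUnit ((a₁ * a₂ * a₃ : ℤ) : ZMod n)) :
    (RainbowZMod.rainbowNumber n a₁ a₂ a₃ b : ℤ) ≤
      2 + ∑ k, (α k : ℤ) * ((RainbowZMod.rainbowNumber (p k) a₁ a₂ a₃ b : ℤ) - 2) := by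
  subst hn
  have h := RainbowZMod.rainbowNumber_prod_le Finset.univ p α hp a₁ a₂ a₃ b hsum hprod
  zify at h
  refine h.trans_eq (congrArg (2 + ·) (Finset.sum_congr rfl fun k _ => ?_))
  have : NeZero (p k) := ⟨(hp k).ne_zero⟩
  rw [Nat.cast_sub (RainbowZMod.two_le_rainbowNumber (p k) a₁ a₂ a₃ b), Nat.cast_ofNat]
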